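/- Conventions. A (real) graded Fréchet space is a complete Hausdorff locally convex space $X$ whose topology is generated by a fixed sequence of seminorms with $\|x\|_k\le\|x\|_{k+1}$ for all $x\in X$, $k\in\mathbb N=\{0,1,2,\dots\}$. It is called standard if for every $x\in X$ there are a constant $c$, a sequence $(x_n)$ in $X$ converging to $x$ and nonnegative numbers $b_n$ such that $\|x_n\|_k\le c\,\|x\|_k$ for all $n,k\in\mathbb N$ and $\|x_n\|_k\le b_n^{\,k}$ for all $n\in\mathbb N$, $k\ge 1$. The space $C([-1,1],X)$ of continuous maps is graded by $\|z\|_k=\sup_{s\in[-1,1]}\|z(s)\|_k$. A function $g:X\to X$ defined near $x$ is Gâteaux differentiable at $x$ with derivative $Dg(x)$, a continuous linear map, if $\lim_{h\to0}h^{-1}(g(x+hu)-g(x))=Dg(x)u$ for all $u\in X$. A continuous map $f:S\to X$, $S=[t_0-r_0,t_0+r_0]\times U\subseteq\mathbb R\times X$, is of class $C^1$ with derivative $Df$ if for each $(t,x)\in S$ there is a continuous linear map $Df(t,x):\mathbb R\times X\to X$ with $\lim_{h\to 0}h^{-1}\big(f(t+h\tau,x+hu)-f(t,x)\big)=Df(t,x)(\tau,u)$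 for all $(\tau,u)\in\mathbb R\times X$ (the limit being over $h\neq0$ with $(t+h\tau,x+hu)\in S$), and $((t,x),(\tau,u))\mapsto Df(t,x)(\tau,u)$ is continuous on $S\times(\mathbb R\times X)$. Theorem 4.1. Let $X$ be a graded Fréchet space such that $X$ and $C([-1,1],X)$ are standard, let $U\subseteq X$ be open, $x_0\in U$, $t_0\in\mathbb R$, $r_0>0$, and let $f:[t_0-r_0,t_0+r_0]\times U\to X$ be continuous. Suppose that for each $t\in[t_0-r_0,t_0+r_0]$ the map $f(t,\cdot):U\to X$ is Gâteaux differentiable on $U$ with derivative $D_xf(t,\cdot)$, and that there is a non-decreasing sequence of nonnegative reals $(c_k)_{k\in\mathbb N}$ such that $$\|D_xf(t,x)u\|_k\le c_k\|u\|_k\qquad\text{for all }(t,x)\in[t_0-r_0,t_0+r_0]\times U,\ u\in X,\ k\in\mathbb N .$$ Then there is $r\in(0,r_0]$ such that the initial value problem $$x'(t)=f(t,x(t)),\quad t\in[t_0-r,t_0+r],\qquad x(t_0)=x_0,$$ has a solution $x\in C^1([t_0-r,t_0+r],X)$ with values in $U$ (with one-sided derivatives at the endpoints). If, in addition, $f$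 is of class $C^1$ on $[t_0-r_0,t_0+r_0]\times U$ and $\|Df(t,x)(\tau,u)\|_k\le c_k(|\tau|+\|u\|_k)$ for all $(t,x)\in[t_0-r_0,t_0+r_0]\times U$, $(\tau,u)\in\mathbb R\times X$, $k\in\mathbb N$, then the solution is unique: for every $r\in(0,r_0]$, any two $C^1$ solutions of the initial value problem on $[t_0-r,t_0+r]$ with values in $U$ coincide. -/

import Mathlib

open Set Filter Topology

/-- The topological vector space `X`, with the sequence `p 0 ≤ p 1 ≤ p 2 ≤ ⋯` of seminorms,
is a (real) graded Fréchet space: it is Hausdorff and complete, and its topology is generated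
by the seminorms. -/
structure IsGradedFrechet {X : Type*} [AddCommGroup X] [Module ℝ X] [UniformSpace X]
    [IsUniformAddGroup X] (p : ℕ → Seminorm ℝ X) : Prop where
  withSeminorms : WithSeminorms (𝕜 := ℝ) (E := X) p
  le_succ : ∀ (k : ℕ) (x : X), p k x ≤ p (k + 1) x
  t2 : T2Space X
  complete : CompleteSpace X

/-- The space `X` with the grading `p` is standard: every `x` is the limit of a sequence `(xₙ)`
with `p k xₙ ≤ c * p k x` for all `k` and `n`, and such that the seminorms of each `xₙ` grow at most
geometrically, `p k xₙ ≤ (bₙ) ^ k`. The geometric bound is asked for `k ≥ 1` only (for `k = 0`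
it would read `p 0 xₙ ≤ 1` and force `p 0 = 0`). -/
def IsStandard {X : Type*} [AddCommGroup X] [Module ℝ X] [TopologicalSpace X]
    (p : ℕ → Seminorm ℝ X) : Prop :=
  ∀ x : X, ∃ (c : ℝ) (y : ℕ → X) (b : ℕ → ℝ),
    Tendsto y atTop (𝓝 x) ∧ (∀ n, 0 ≤ b n) ∧
      (∀ n k, p k (y n) ≤ c * p k x) ∧ (∀ n k, 1 ≤ k → p k (y n) ≤ b n ^ k)

/-- The supremum seminorm `z ↦ sup_{s ∈ [-1, 1]} q (z s)` on `C([-1, 1], X)` attached to a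
seminorm `q` on `X`; see `pathSeminorm_apply`. -/
noncomputable def pathSeminorm {X : Type*} [AddCommGroup X] [Module ℝ X] [TopologicalSpace X]
    [IsTopologicalAddGroup X] [ContinuousSMul ℝ X] (q : Seminorm ℝ X) :
    Seminorm ℝ C(Icc (-1 : ℝ) 1, X) :=
  ⨆ s : Icc (-1 : ℝ) 1, q.comp (ContinuousMap.evalCLM ℝ s).toLinearMap

theorem pathSeminorm_apply {X : Type*} [AddCommGroup X] [Module ℝ X] [TopologicalSpace X]
    [IsTopologicalAddGroup X] [ContinuousSMul ℝ X] (q : Seminorm ℝ X) (hq : Continuous q)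
    (z : C(Icc (-1 : ℝ) 1, X)) :
    pathSeminorm q z = ⨆ s : Icc (-1 : ℝ) 1, q (z s) := by
  unfold pathSeminorm
  rw [Seminorm.iSup_apply]
  · rfl
  · rw [Seminorm.bddAbove_range_iff]
    intro z
    exact (isCompact_range (hq.comp z.continuous)).bddAbove

/-- `f'` is the Gâteaux derivative of `f` at `x`: for every direction `u`,
`(f (x + h u) - f x) / h → f' u` as `h → 0`. -/
def HasGateauxDerivAt {X Y : Type*} [AddCommGroup X] [Module ℝ X] [TopologicalSpace X]
    [AddCommGroup Y] [Module ℝ Y] [TopologicalSpace Y] [ContinuousSMul ℝ Y]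
    (f : X → Y) (f' : X →L[ℝ] Y) (x : X) : Prop :=
  ∀ u : X, HasDerivAt (fun h : ℝ => f (x + h • u)) (f' u) 0

/-- `f` is of class `C¹` on `S` with derivative `f'` (the usual notion between Fréchet spaces):
`f` is continuous on `S`, at each point `z` of `S` it has, within `S`, the directional
derivative `f' z v` in every direction `v`, and `(z, v) ↦ f' z v` is jointly continuous
for `z ∈ S`. -/
structure IsC1On {E Y : Type*} [AddCommGroup E] [Module ℝ E] [TopologicalSpace E]
    [AddCommGroup Y] [Module ℝ Y] [TopologicalSpace Y] [ContinuousSMul ℝ Y]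
    (f : E → Y) (f' : E → E →L[ℝ] Y) (S : Set E) : Prop where
  continuousOn : ContinuousOn f S
  hasDeriv : ∀ z ∈ S, ∀ v : E,
    HasDerivWithinAt (fun h : ℝ => f (z + h • v)) (f' z v) {h : ℝ | z + h • v ∈ S} 0
  continuousOn_deriv : ContinuousOn (fun q : E × E => f' q.1 q.2) (S ×ˢ univ)

/-- `x` is a `C¹` solution on `[t₀ - r, t₀ + r]`, with values in `U`, of `x' = f(t, x)`,
`x(t₀) = x₀`. Derivatives at the two endpoints are one-sided; values of `x` outside
`[t₀ - r, t₀ + r]` are irrelevant. -/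
structure IsC1Solution {X : Type*} [AddCommGroup X] [Module ℝ X] [TopologicalSpace X]
    [ContinuousSMul ℝ X] (f : ℝ × X → X) (U : Set X) (t₀ : ℝ) (x₀ : X) (r : ℝ)
    (x : ℝ → X) : Prop where
  mem : ∀ t ∈ Icc (t₀ - r) (t₀ + r), x t ∈ U
  hasDeriv : ∀ t ∈ Icc (t₀ - r) (t₀ + r),
    HasDerivWithinAt x (f (t, x t)) (Icc (t₀ - r) (t₀ + r)) t
  continuousOn : ContinuousOn x (Icc (t₀ - r) (t₀ + r))
  continuousOn_deriv : ContinuousOn (fun t => f (t, x t)) (Icc (t₀ - r) (t₀ + r))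
  initial : x t₀ = x₀

/-!
A complete Hausdorff locally convex space is a closed subspace of the product of its local Banach
spaces, so curves in it can be integrated and differentiated one seminorm at a time. By the mean
value inequality `f (t, ·)` is Lipschitz near `x₀` for each seminorm `p i`, with its own constant
`c i` and no loss of derivatives. Weighting the sup norm of `p i` by `exp (-2 * c i * |t - t₀|)`
therefore makes the Picard operator a `1/2`-contraction for all the seminorms at once, whatever the
growth of `c`. The length of the time interval is restricted only by the invariance of one closed
ball, of a single continuous seminorm. For uniqueness, two solutions that agree at one time agree
near it, by Grönwall's inequality in every local Banach space, and the interval is connected.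
-/

open scoped NNReal

universe u

section LocalBanachSpaces

variable {X : Type u} [AddCommGroup X] [Module ℝ X]

/-- The space `X`, topologized by the single seminorm `q`. -/
def SeminormedBy (_q : Seminorm ℝ X) : Type u := X

noncomputable instance (q : Seminorm ℝ X) : SeminormedAddCommGroup (SeminormedBy q) :=
  q.toAddGroupSeminorm.toSeminormedAddCommGroup

instance (q : Seminorm ℝ X) : Module ℝ (SeminormedBy q) := inferInstanceAs (Module ℝ X)

noncomputable instance (q : Seminorm ℝ X) : NormedSpace ℝ (SeminormedBy q) where
  norm_smul_le := fun _ _ => (map_smul_eq_mul q _ _).le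

/-- The local Banach space of `X` at the seminorm `q`: the Hausdorff completion of `(X, q)`. -/
abbrev LocalBanachSpace (q : Seminorm ℝ X) : Type u :=
  UniformSpace.Completion (SeminormedBy q)

variable {ι : Type*} {p : ι → Seminorm ℝ X}

section TopologicalSpace

variable [TopologicalSpace X] [IsTopologicalAddGroup X]

/-- The canonical map of `X` to its local Banach space at one of the seminorms that generate the
topology. -/
noncomputable def localBanachMap (hp : WithSeminorms p) (i : ι) :
    X →L[ℝ] LocalBanachSpace (p i) where
  toLinearMap :=
    (UniformSpace.Completion.toComplₗᵢ (𝕜 := ℝ) (E := SeminormedBy (p i))).toLinearMap ∘ₗ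
      { toFun := fun x => x, map_add' := fun _ _ => rfl, map_smul' := fun _ _ => rfl }
  cont := by
    refine continuous_of_continuousAt_zero (LinearMap.comp _ _) ?_
    rw [ContinuousAt, map_zero, tendsto_zero_iff_norm_tendsto_zero]
    refine ((hp.continuous_seminorm i).tendsto' 0 0 (map_zero _)).congr fun x => ?_
    exact (UniformSpace.Completion.norm_coe (E := SeminormedBy (p i)) x).symm

@[simp]
theorem norm_localBanachMap (hp : WithSeminorms p) (i : ι) (x : X) :
    ‖localBanachMap hp i x‖ = p i x :=
  UniformSpace.Completion.norm_coe (E := SeminormedBy (p i)) x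

theorem norm_localBanachMap_sub (hp : WithSeminorms p) (i : ι) (x y : X) :
    ‖localBanachMap hp i x - localBanachMap hp i y‖ = p i (x - y) := by
  rw [← map_sub, norm_localBanachMap]

/-- The canonical map of `X` to the product of its local Banach spaces. -/
noncomputable def localBanachEmbedding (hp : WithSeminorms p) :
    X →L[ℝ] ∀ i, LocalBanachSpace (p i) :=
  ContinuousLinearMap.pi (localBanachMap hp)

theorem isInducing_localBanachEmbedding (hp : WithSeminorms p) :
    IsInducing (localBanachEmbedding hp) := by
  rw [IsTopologicalAddGroup.isInducing_iff_nhds_zero, nhds_pi, Filter.pi, Filter.comap_iInf,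
    (SeminormFamily.withSeminorms_iff_nhds_eq_iInf p).1 hp]
  refine iInf_congr fun i => ?_
  rw [Pi.zero_apply, ← comap_norm_nhds_zero (E := LocalBanachSpace (p i)), Filter.comap_comap,
    Filter.comap_comap]
  exact congrArg (Filter.comap · (𝓝 0)) (funext fun x => (norm_localBanachMap hp i x).symm)

theorem tendsto_iff_localBanachMap (hp : WithSeminorms p) {α : Type*} {u : α → X}
    {l : Filter α} {x : X} :
    Tendsto u l (𝓝 x) ↔
      ∀ i, Tendsto (fun a => localBanachMap hp i (u a)) l (𝓝 (localBanachMap hp i x)) :=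
  (isInducing_localBanachEmbedding hp).tendsto_nhds_iff.trans tendsto_pi_nhds

theorem localBanachEmbedding_injective [T0Space X] (hp : WithSeminorms p) :
    Function.Injective (localBanachEmbedding hp) :=
  (isInducing_localBanachEmbedding hp).injective

theorem hasDerivAtFilter_localBanachMap [ContinuousSMul ℝ X] (hp : WithSeminorms p) (i : ι)
    {x : ℝ → X} {x' : X} {L : Filter (ℝ × ℝ)} (h : HasDerivAtFilter x x' L) :
    HasDerivAtFilter (fun t => localBanachMap hp i (x t)) (localBanachMap hp i x') L := by
  refine .of_isLittleOTVS (((localBanachMap hp i).isBigOTVS_comp.trans_isLittleOTVS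
    h.isLittleOTVS).congr_left fun z => ?_)
  simp

theorem hasDerivAt_of_localBanachMap [ContinuousSMul ℝ X] (hp : WithSeminorms p) {x : ℝ → X}
    {x' : X} {t : ℝ}
    (h : ∀ i, HasDerivAt (fun t => localBanachMap hp i (x t)) (localBanachMap hp i x') t) :
    HasDerivAt x x' t := by
  refine .of_isLittleOTVS ?_
  rw [Asymptotics.isLittleOTVS_iff_tendsto_inv_smul
    (Eventually.of_forall fun z hz => by simp [sub_eq_zero.1 hz]), tendsto_iff_localBanachMap hp]
  intro i
  simpa using (h i).isLittleOTVS.tendsto_inv_smul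

end TopologicalSpace

section UniformSpace

variable [UniformSpace X] [IsUniformAddGroup X]

theorem isClosed_image_localBanachEmbedding [CompleteSpace X] (hp : WithSeminorms p) {B : Set X}
    (hB : IsClosed B) : IsClosed (localBanachEmbedding hp '' B) :=
  ((AddMonoidHom.isUniformInducing_of_isInducing
    (isInducing_localBanachEmbedding hp)).isComplete_iff.2 hB.isComplete).isClosed

end UniformSpace

end LocalBanachSpaces

section Primitive

open MeasureTheory

theorem continuous_integral_continuousMap {K Y : Type*} [TopologicalSpace K] [CompactSpace K]
    [MeasurableSpace K] [BorelSpace K] (μ : Measure K) [IsFiniteMeasure μ]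
    [NormedAddCommGroup Y] [NormedSpace ℝ Y] [SecondCountableTopologyEither K Y] :
    Continuous fun g : C(K, Y) => ∫ s, g s ∂μ := by
  have hint (g : C(K, Y)) : Integrable g μ :=
    g.continuous.integrable_of_hasCompactSupport (HasCompactSupport.of_compactSpace g)
  refine (LipschitzWith.of_dist_le_mul (K := (μ.real univ).toNNReal) fun g h => ?_).continuous
  rw [dist_eq_norm, dist_eq_norm, ← integral_sub (hint g) (hint h),
    Real.coe_toNNReal _ measureReal_nonneg, mul_comm]
  exact norm_integral_le_of_norm_le_const (.of_forall fun s => (g - h).norm_coe_le_norm s)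

variable {X : Type u} [AddCommGroup X] [Module ℝ X] [UniformSpace X] [IsUniformAddGroup X]
  [CompleteSpace X] [ContinuousSMul ℝ X] {ι : Type*} {p : ι → Seminorm ℝ X}

open scoped unitInterval in
theorem exists_localBanachMap_eq_integral_unitInterval (hp : WithSeminorms p) (g : C(I, X)) :
    ∃ v : X, ∀ i, localBanachMap hp i v = ∫ s : I, localBanachMap hp i (g s) := by
  have := hp.toLocallyConvexSpace
  -- A Bernstein approximation of `g` is a finite combination of values of `g` with scalar
  -- coefficients, so its integral exists in `X` itself.
  let v (n : ℕ) : X := ∑ k : Fin (n + 1), (∫ s : I, bernstein n k s) • g (bernstein.z k)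
  have hv (i : ι) (n : ℕ) : localBanachMap hp i (v n) =
      ∫ s : I, localBanachMap hp i (bernsteinApproximation n g s) := by
    have hint (k : Fin (n + 1)) : Integrable fun s : I =>
        bernstein n k s • localBanachMap hp i (g (bernstein.z k)) :=
      (by fun_prop : Continuous _).integrable_of_hasCompactSupport
        (HasCompactSupport.of_compactSpace _)
    simp only [v, bernsteinApproximation.apply, map_sum, map_smul, ← integral_smul_const]
    exact (integral_finsetSum _ fun k _ => hint k).symm
  have hlim : Tendsto (fun n => localBanachEmbedding hp (v n)) atTop
      (𝓝 fun i => ∫ s : I, localBanachMap hp i (g s)) := by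
    refine tendsto_pi_nhds.2 fun i => ?_
    have hcont : Continuous fun h : C(I, X) => ∫ s : I, localBanachMap hp i (h s) :=
      (continuous_integral_continuousMap volume).comp
        (ContinuousMap.continuous_postcomp (localBanachMap hp i : C(X, LocalBanachSpace (p i))))
    exact ((hcont.tendsto g).comp (bernsteinApproximation_uniform g)).congr fun n => (hv i n).symm
  obtain ⟨v, -, hv⟩ := (isClosed_image_localBanachEmbedding hp isClosed_univ).mem_of_tendsto hlim
    (.of_forall fun n => mem_image_of_mem _ (mem_univ (v n)))
  exact ⟨v, congrFun hv⟩

theorem exists_localBanachMap_eq_intervalIntegral (hp : WithSeminorms p) (g : C(ℝ, X)) (a b : ℝ) :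
    ∃ v : X, ∀ i, localBanachMap hp i v = ∫ t in a..b, localBanachMap hp i (g t) := by
  obtain ⟨v, hv⟩ := exists_localBanachMap_eq_integral_unitInterval hp
    ⟨fun s => g (a + (b - a) * s), by fun_prop⟩
  refine ⟨(b - a) • v, fun i => ?_⟩
  have h := intervalIntegral.smul_integral_comp_add_mul (a := 0) (b := 1)
    (fun t => localBanachMap hp i (g t)) (b - a) a
  rw [mul_zero, mul_one, add_zero, add_sub_cancel] at h
  rw [map_smul, hv i, ← h, intervalIntegral.integral_of_le zero_le_one,
    ← integral_Icc_eq_integral_Ioc, ← integral_subtype measurableSet_Icc]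
  rfl

theorem exists_primitive [T2Space X] (hp : WithSeminorms p) (g : C(ℝ, X)) (a : ℝ) (x₀ : X) :
    ∃ w : C(ℝ, X), w a = x₀ ∧ ∀ t, HasDerivAt w (g t) t := by
  choose v hv using exists_localBanachMap_eq_intervalIntegral hp g a
  have hderiv (t : ℝ) : HasDerivAt (fun t => x₀ + v t) (g t) t := by
    refine hasDerivAt_of_localBanachMap hp fun i => ?_
    have hg : Continuous fun t => localBanachMap hp i (g t) := by fun_prop
    simp only [map_add, hv]
    exact (hg.integral_hasStrictDerivAt a t).hasDerivAt.const_add _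
  have hva : v a = 0 := by
    refine localBanachEmbedding_injective hp (funext fun i => (hv a i).trans ?_)
    rw [intervalIntegral.integral_same, map_zero, Pi.zero_apply]
  have hcont : Continuous fun t => x₀ + v t :=
    continuous_iff_continuousAt.2 fun t => (hderiv t).hasFDerivAt.continuousAt
  exact ⟨⟨_, hcont⟩, by simp [hva], hderiv⟩

end Primitive

theorem exists_eq_map_of_dist_map_le {ι E : Type*} {M : ι → Type*} [∀ i, MetricSpace (M i)]
    [∀ i, CompleteSpace (M i)] {e : E → ∀ i, M i} {S : Set E} (hS : S.Nonempty)
    (hcl : IsClosed (e '' S)) {T : E → E} (hT : MapsTo T S S) {κ : ι → ℝ≥0} (hκ : ∀ i, κ i < 1)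
    (hdist : ∀ i, ∀ x ∈ S, ∀ y ∈ S, dist (e (T x) i) (e (T y) i) ≤ κ i * dist (e x i) (e y i)) :
    ∃ x ∈ S, e (T x) = e x := by
  obtain ⟨x₀, hx₀⟩ := hS
  have hmem (n : ℕ) : T^[n] x₀ ∈ S := hT.iterate n hx₀
  have hgeom (i : ι) (n : ℕ) : dist (e (T^[n] x₀) i) (e (T^[n + 1] x₀) i) ≤
      dist (e x₀ i) (e (T x₀) i) * κ i ^ n := by
    induction n with
    | zero => simp
    | succ n ih =>
      rw [T.iterate_succ_apply', T.iterate_succ_apply' (n + 1), pow_succ', mul_left_comm]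
      exact (hdist i _ (hmem n) _ (hmem (n + 1))).trans (by gcongr)
  choose y hy using fun i => cauchySeq_tendsto_of_complete
    (cauchySeq_of_le_geometric _ _ (NNReal.coe_lt_one.2 (hκ i)) (hgeom i))
  obtain ⟨x, hxS, rfl⟩ : y ∈ e '' S := hcl.mem_of_tendsto (tendsto_pi_nhds.2 hy)
    (.of_forall fun n => mem_image_of_mem e (hmem n))
  refine ⟨x, hxS, funext fun i => ?_⟩
  have hTx : Tendsto (fun n => e (T^[n + 1] x₀) i) atTop (𝓝 (e (T x) i)) := by
    rw [tendsto_iff_dist_tendsto_zero]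
    refine squeeze_zero (fun _ => dist_nonneg) (fun n => ?_)
      (by simpa using (tendsto_iff_dist_tendsto_zero.1 (hy i)).const_mul (κ i : ℝ))
    rw [T.iterate_succ_apply']
    exact hdist i _ (hmem n) x hxS
  exact tendsto_nhds_unique hTx ((hy i).comp (tendsto_add_atTop_nat 1))

section WeightedCurves

variable {X : Type u} [AddCommGroup X] [Module ℝ X] {ι : Type*} {p : ι → Seminorm ℝ X}
  {K : Type*} [TopologicalSpace K]

/-- The images of a curve `z` in the local Banach spaces of `X`, the `i`-th one multiplied by the
weight `w i`. The sup norms of these images are the weighted norms `sup_t w i t * p i (z t)`. -/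
noncomputable def weightedCurve [TopologicalSpace X] [IsTopologicalAddGroup X]
    (hp : WithSeminorms p) (w : ι → C(K, ℝ)) (z : C(K, X)) (i : ι) :
    C(K, LocalBanachSpace (p i)) :=
  w i • (localBanachMap hp i : C(X, LocalBanachSpace (p i))).comp z

@[simp]
theorem weightedCurve_apply [TopologicalSpace X] [IsTopologicalAddGroup X]
    (hp : WithSeminorms p) (w : ι → C(K, ℝ)) (z : C(K, X)) (i : ι) (t : K) :
    weightedCurve hp w z i t = w i t • localBanachMap hp i (z t) :=
  rfl

theorem weightedCurve_injective [TopologicalSpace X] [IsTopologicalAddGroup X] [T0Space X]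
    (hp : WithSeminorms p) {w : ι → C(K, ℝ)} (hw : ∀ i t, w i t ≠ 0) :
    Function.Injective (weightedCurve hp w) := fun y z h => by
  ext t
  refine localBanachEmbedding_injective hp (funext fun i => ?_)
  exact smul_right_injective _ (hw i t) (DFunLike.congr_fun (congrFun h i) t)

theorem isClosed_image_weightedCurve [UniformSpace X] [IsUniformAddGroup X] [CompleteSpace X]
    (hp : WithSeminorms p) {w : ι → C(K, ℝ)} (hw : ∀ i t, w i t ≠ 0) {B : Set X}
    (hB : IsClosed B) : IsClosed (weightedCurve hp w '' {z | ∀ t, z t ∈ B}) := by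
  refine isClosed_of_closure_subset fun h hh => ?_
  have hmem (t : K) : (fun i => (w i t)⁻¹ • h i t) ∈ localBanachEmbedding hp '' B := by
    have hev : Continuous fun (h : ∀ i, C(K, LocalBanachSpace (p i))) i => (w i t)⁻¹ • h i t :=
      continuous_pi fun i =>
        ((continuous_eval_const t).comp (continuous_apply i)).const_smul (w i t)⁻¹
    rw [← (isClosed_image_localBanachEmbedding hp hB).closure_eq]
    refine map_mem_closure hev hh ?_
    rintro - ⟨z, hz, rfl⟩
    exact ⟨z t, hz t, funext fun i => (inv_smul_smul₀ (hw i t) _).symm⟩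
  choose z hzB hz using hmem
  have hcont : Continuous z := by
    refine (isInducing_localBanachEmbedding hp).continuous_iff.2 (continuous_pi fun i => ?_)
    have : Continuous fun t => (w i t)⁻¹ • h i t :=
      ((w i).continuous.inv₀ (hw i)).smul (h i).continuous
    exact this.congr fun t => (congrFun (hz t) i).symm
  refine ⟨⟨z, hcont⟩, hzB, funext fun i => ContinuousMap.ext fun t => ?_⟩
  rw [weightedCurve_apply, ← smul_inv_smul₀ (hw i t) (h i t)]
  exact congrArg (w i t • ·) (congrFun (hz t) i)

end WeightedCurves

section Segments

variable {Y : Type*} [NormedAddCommGroup Y] [NormedSpace ℝ Y] {g g' : ℝ → Y} {s : Set ℝ}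

theorem hasDerivWithinAt_comp_lineMap (hs : Convex ℝ s)
    (hg : ∀ t ∈ s, HasDerivWithinAt g (g' t) s t) {a b : ℝ} (ha : a ∈ s) (hb : b ∈ s) {σ : ℝ}
    (hσ : σ ∈ Icc (0 : ℝ) 1) :
    HasDerivWithinAt (fun σ => g (AffineMap.lineMap a b σ))
      ((b - a) • g' (AffineMap.lineMap a b σ)) (Icc 0 1) σ :=
  have hmaps : MapsTo (AffineMap.lineMap a b : ℝ → ℝ) (Icc 0 1) s := fun _ => hs.lineMap_mem ha hb
  (hg _ (hmaps hσ)).scomp σ AffineMap.hasDerivWithinAt_lineMap hmaps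

theorem norm_sub_le_of_norm_deriv_le_comp_abs (hs : Convex ℝ s)
    (hg : ∀ t ∈ s, HasDerivWithinAt g (g' t) s t) {β β' : ℝ → ℝ}
    (hβ : ∀ τ, HasDerivAt β (β' τ) τ) (hβ₀ : 0 ≤ β 0) {a : ℝ} (ha : a ∈ s)
    (hbound : ∀ t ∈ s, ‖g' t‖ ≤ β' |t - a|) {t : ℝ} (ht : t ∈ s) :
    ‖g t - g a‖ ≤ β |t - a| := by
  have hline := fun {σ} (hσ : σ ∈ Icc (0 : ℝ) 1) =>
    (hasDerivWithinAt_comp_lineMap hs hg ha ht hσ).sub_const (g a)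
  have h := image_norm_le_of_norm_deriv_right_le_deriv_boundary
    (B := fun σ => β (σ * |t - a|)) (B' := fun σ => β' (σ * |t - a|) * |t - a|)
    (fun σ hσ => (hline hσ).continuousWithinAt)
    (fun σ hσ => (hline (Ico_subset_Icc_self hσ)).mono_of_mem_nhdsWithin
      (Icc_mem_nhdsGE_of_mem hσ))
    (by simpa using hβ₀) (fun σ => (hβ _).comp σ (hasDerivAt_mul_const _))
    (fun σ hσ => ?_) (right_mem_Icc.2 zero_le_one)
  · simpa using h
  · have hmem := hs.lineMap_mem ha ht (Ico_subset_Icc_self hσ)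
    have habs : |AffineMap.lineMap a t σ - a| = σ * |t - a| := by
      rw [AffineMap.lineMap_apply_ring', add_sub_cancel_right, abs_mul, abs_of_nonneg hσ.1]
    rw [norm_smul, mul_comm, Real.norm_eq_abs, ← habs]
    gcongr
    exact hbound _ hmem

theorem eqOn_zero_of_norm_deriv_le_mul_norm (hs : Convex ℝ s)
    (hg : ∀ t ∈ s, HasDerivWithinAt g (g' t) s t) {L : ℝ}
    (hbound : ∀ t ∈ s, ‖g' t‖ ≤ L * ‖g t‖) {a : ℝ} (ha : a ∈ s) (hga : g a = 0) :
    EqOn g 0 s := fun t ht => by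
  have hline := fun {σ} (hσ : σ ∈ Icc (0 : ℝ) 1) =>
    hasDerivWithinAt_comp_lineMap hs hg ha ht hσ
  have h := eq_zero_of_abs_deriv_le_mul_abs_self_of_eq_zero_right (K := |t - a| * L)
    (fun σ hσ => (hline hσ).continuousWithinAt)
    (fun σ hσ => (hline (Ico_subset_Icc_self hσ)).mono_of_mem_nhdsWithin
      (Icc_mem_nhdsGE_of_mem hσ))
    (by simpa using hga) (fun σ hσ => ?_) 1 (right_mem_Icc.2 zero_le_one)
  · simpa using h
  · rw [norm_smul, mul_assoc, Real.norm_eq_abs]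
    gcongr
    exact hbound _ (hs.lineMap_mem ha ht (Ico_subset_Icc_self hσ))

end Segments

section LipschitzOnSeminorms

variable {X : Type u} [AddCommGroup X] [Module ℝ X] {ι : Type*} {p : ι → Seminorm ℝ X}

/-- `g` is Lipschitz on `B` for each of the seminorms `p i`, with constant `c i`. -/
def LipschitzOnSeminorms (p : ι → Seminorm ℝ X) (c : ι → ℝ≥0) (B : Set X) (g : X → X) : Prop :=
  ∀ i, ∀ x ∈ B, ∀ y ∈ B, p i (g x - g y) ≤ c i * p i (x - y)

theorem LipschitzOnSeminorms.finset_sup_sub_le {c : ι → ℝ≥0} {B : Set X} {g : X → X}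
    (hg : LipschitzOnSeminorms p c B g) (s : Finset ι) {x y : X} (hx : x ∈ B) (hy : y ∈ B) :
    (s.sup p) (g x - g y) ≤ s.sup c * (s.sup p) (x - y) :=
  Seminorm.finset_sup_apply_le (by positivity) fun i hi =>
    (hg i x hx y hy).trans (by
      gcongr
      · exact Finset.le_sup hi
      · exact Seminorm.le_finset_sup_apply hi)

variable [TopologicalSpace X]

theorem exists_seminorm_le_of_lipschitzOnSeminorms [IsTopologicalAddGroup X]
    (hp : WithSeminorms p) {s : Finset ι} {x₀ : X} {ε : ℝ} (hε : 0 ≤ ε) {J : Set ℝ}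
    (hJ : IsCompact J) {f : ℝ × X → X}
    (hf : ContinuousOn f (J ×ˢ (s.sup p).closedBall x₀ ε)) {c : ι → ℝ≥0}
    (hlip : ∀ t ∈ J, LipschitzOnSeminorms p c ((s.sup p).closedBall x₀ ε) fun x => f (t, x)) :
    ∃ C > 0, ∀ t ∈ J, ∀ x ∈ (s.sup p).closedBall x₀ ε, (s.sup p) (f (t, x)) ≤ C := by
  have hx₀ := (s.sup p).mem_closedBall_self hε (x := x₀)
  have hsup : Continuous (s.sup p : Seminorm ℝ X) :=
    Seminorm.continuous_finsetSup fun i _ => hp.continuous_seminorm i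
  obtain ⟨M, hM⟩ := hJ.bddAbove_image (f := fun t => (s.sup p) (f (t, x₀)))
    (hsup.comp_continuousOn (hf.comp (by fun_prop) fun t ht => ⟨ht, hx₀⟩))
  refine ⟨max M 0 + s.sup c * ε + 1, by positivity, fun t ht x hx => ?_⟩
  calc (s.sup p) (f (t, x)) = (s.sup p) (f (t, x₀) + (f (t, x) - f (t, x₀))) := by
        rw [add_sub_cancel]
    _ ≤ (s.sup p) (f (t, x₀)) + (s.sup p) (f (t, x) - f (t, x₀)) := map_add_le_add _ _ _
    _ ≤ max M 0 + s.sup c * ε := by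
        gcongr
        · exact (hM (mem_image_of_mem _ ht)).trans (le_max_left _ _)
        · exact ((hlip t ht).finset_sup_sub_le s hx hx₀).trans (by gcongr; exact hx)
    _ ≤ max M 0 + s.sup c * ε + 1 := (lt_add_one _).le

theorem HasGateauxDerivAt.hasDerivAt_comp_lineMap {Y : Type*} [NormedAddCommGroup Y]
    [NormedSpace ℝ Y] {g : X → Y} {g' : X →L[ℝ] Y} {x y : X} {σ : ℝ}
    (hg : HasGateauxDerivAt g g' (AffineMap.lineMap x y σ)) :
    HasDerivAt (fun σ => g (AffineMap.lineMap x y σ)) (g' (y - x)) σ := by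
  have h : HasDerivAt _ _ (σ - σ) := (sub_self σ).symm ▸ hg (y - x)
  convert h.comp_sub_const σ σ using 3 with τ
  simp only [AffineMap.lineMap_apply_module', sub_smul]
  abel

theorem lipschitzOnSeminorms_of_hasGateauxDerivAt [IsTopologicalAddGroup X]
    [ContinuousSMul ℝ X] (hp : WithSeminorms p) {B : Set X} (hB : Convex ℝ B) {g : X → X}
    {g' : X → X →L[ℝ] X}
    (hg : ∀ x ∈ B, HasGateauxDerivAt g (g' x) x) {c : ι → ℝ≥0}
    (hbound : ∀ x ∈ B, ∀ u i, p i (g' x u) ≤ c i * p i u) :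
    LipschitzOnSeminorms p c B g := fun i x hx y hy => by
  have hmem {σ : ℝ} (hσ : σ ∈ Icc (0 : ℝ) 1) : AffineMap.lineMap y x σ ∈ B :=
    hB.lineMap_mem hy hx hσ
  have hderiv (z : X) (hz : z ∈ B) :
      HasGateauxDerivAt (fun x => localBanachMap hp i (g x)) (localBanachMap hp i ∘L g' z) z :=
    fun u => hasDerivAtFilter_localBanachMap hp i (hg z hz u)
  have h := norm_image_sub_le_of_norm_deriv_le_segment_01' (C := c i * p i (x - y))
    (fun σ hσ => (hderiv _ (hmem hσ)).hasDerivAt_comp_lineMap.hasDerivWithinAt) fun σ hσ => by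
      rw [ContinuousLinearMap.comp_apply, norm_localBanachMap]
      exact hbound _ (hmem (Ico_subset_Icc_self hσ)) _ _
  simpa [norm_localBanachMap_sub] using h

end LipschitzOnSeminorms

section Bielecki

/-- The Bielecki weight: for the sup norm with this weight, the integral of a function over
`[a, t]` is at most `(2 * L)⁻¹` times that function. -/
noncomputable def bieleckiWeight (s : Set ℝ) (a : ℝ) (L : ℝ≥0) : C(s, ℝ) where
  toFun t := Real.exp (-(2 * L * |t - a|))

theorem bieleckiWeight_pos (s : Set ℝ) (a : ℝ) (L : ℝ≥0) (t : s) : 0 < bieleckiWeight s a L t :=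
  Real.exp_pos _

theorem norm_bieleckiWeight_smul_le {Y : Type*} [NormedAddCommGroup Y] [NormedSpace ℝ Y]
    {s : Set ℝ} [CompactSpace s] (hs : Convex ℝ s) {g g' : ℝ → Y}
    (hg : ∀ t ∈ s, HasDerivWithinAt g (g' t) s t) {a : ℝ} (ha : a ∈ s) (hga : g a = 0) {L : ℝ≥0}
    {u : C(s, Y)} (hbound : ∀ t : s, ‖g' t‖ ≤ L * ‖u t‖) (t : s) :
    ‖bieleckiWeight s a L t • g t‖ ≤ 2⁻¹ * ‖bieleckiWeight s a L • u‖ := by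
  set D := ‖bieleckiWeight s a L • u‖
  have hu (t : s) : ‖u t‖ ≤ Real.exp (2 * L * |t - a|) * D := by
    have h : ‖bieleckiWeight s a L t • u t‖ ≤ D := (bieleckiWeight s a L • u).norm_coe_le_norm t
    rwa [norm_smul, Real.norm_of_nonneg (bieleckiWeight_pos s a L t).le, bieleckiWeight,
      ContinuousMap.coe_mk, Real.exp_neg, inv_mul_le_iff₀ (Real.exp_pos _)] at h
  have hβ (τ : ℝ) : HasDerivAt (fun τ => 2⁻¹ * D * Real.exp (2 * L * τ))
      (L * (Real.exp (2 * L * τ) * D)) τ := by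
    refine (((hasDerivAt_id τ).const_mul (2 * (L : ℝ))).exp.const_mul (2⁻¹ * D)).congr_deriv ?_
    rw [id]
    ring
  have h := norm_sub_le_of_norm_deriv_le_comp_abs hs hg hβ (by positivity) ha
    (fun t ht => (hbound ⟨t, ht⟩).trans (by gcongr; exact hu ⟨t, ht⟩)) t.2
  rw [hga, sub_zero] at h
  rwa [norm_smul, Real.norm_of_nonneg (bieleckiWeight_pos s a L t).le, bieleckiWeight,
    ContinuousMap.coe_mk, Real.exp_neg, inv_mul_le_iff₀ (Real.exp_pos _), mul_comm]

end Bielecki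

section PicardIterate

variable {X : Type u} [AddCommGroup X] [Module ℝ X]

/-- The curve `w` is the Picard iterate of the curve `z` for `x' = f(t, x)`, `x(t₀) = x₀`, that is,
`w t = x₀ + ∫ s in t₀..t, f (s, z s)` for `t ∈ [a, b]`. -/
structure IsPicardIterate [TopologicalSpace X] [ContinuousSMul ℝ X] (f : ℝ × X → X) (t₀ : ℝ)
    (x₀ : X) {a b : ℝ} (z : C(Icc a b, X)) (w : C(ℝ, X)) : Prop where
  initial : w t₀ = x₀
  hasDerivAt : ∀ t : Icc a b, HasDerivAt w (f (t, z t)) t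

variable {ι : Type*} {p : ι → Seminorm ℝ X} {f : ℝ × X → X} {B : Set X} {t₀ a b : ℝ} {x₀ : X}

theorem exists_isPicardIterate [UniformSpace X] [IsUniformAddGroup X] [ContinuousSMul ℝ X]
    [T2Space X] [CompleteSpace X] (hp : WithSeminorms p) (hab : a ≤ b)
    (hf : ContinuousOn f (Icc a b ×ˢ B)) (t₀ : ℝ) (x₀ : X) {z : C(Icc a b, X)}
    (hz : ∀ t, z t ∈ B) : ∃ w : C(ℝ, X), IsPicardIterate f t₀ x₀ z w := by
  let g : C(Icc a b, X) := ⟨fun t => f (t, z t),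
    hf.comp_continuous (by fun_prop) fun t => ⟨t.2, hz t⟩⟩
  obtain ⟨w, hw₀, hw⟩ := exists_primitive hp (g.IccExtend hab) t₀ x₀
  refine ⟨w, hw₀, fun t => ?_⟩
  have h := hw t
  rwa [ContinuousMap.coe_IccExtend, IccExtend_val] at h

variable [TopologicalSpace X] [IsTopologicalAddGroup X] [ContinuousSMul ℝ X]
  {z z₁ z₂ : C(Icc a b, X)} {w w₁ w₂ : C(ℝ, X)}

theorem IsPicardIterate.hasDerivAt_localBanachMap (hw : IsPicardIterate f t₀ x₀ z w)
    (hp : WithSeminorms p) (i : ι) (t : Icc a b) :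
    HasDerivAt (fun t => localBanachMap hp i (w t)) (localBanachMap hp i (f (t, z t))) t :=
  hasDerivAtFilter_localBanachMap hp i (hw.hasDerivAt t)

theorem IsPicardIterate.seminorm_sub_le (hw : IsPicardIterate f t₀ x₀ z w) (hp : WithSeminorms p)
    (ht₀ : t₀ ∈ Icc a b) {i : ι} {C : ℝ} (hC : ∀ t : Icc a b, p i (f (t, z t)) ≤ C)
    (t : Icc a b) : p i (w t - x₀) ≤ C * |(t : ℝ) - t₀| := by
  have hderiv (t : Icc a b) := hw.hasDerivAt_localBanachMap hp i t
  have h := norm_sub_le_of_norm_deriv_le_comp_abs (convex_Icc a b)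
    (fun t ht => (hderiv ⟨t, ht⟩).differentiableAt.hasDerivAt.hasDerivWithinAt)
    (fun τ => hasDerivAt_const_mul C) (mul_zero C).ge ht₀
    (fun t ht => by
      rw [(hderiv ⟨t, ht⟩).deriv, norm_localBanachMap]
      exact hC ⟨t, ht⟩) t.2
  rwa [norm_localBanachMap_sub, hw.initial] at h

theorem IsPicardIterate.mem_closedBall (hw : IsPicardIterate f t₀ x₀ z w) (hp : WithSeminorms p)
    (ht₀ : t₀ ∈ Icc a b) {s : Finset ι} {C ε : ℝ} (hε : 0 ≤ ε)
    (hC : ∀ t : Icc a b, (s.sup p) (f (t, z t)) ≤ C)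
    (hCε : ∀ t ∈ Icc a b, C * |t - t₀| ≤ ε) (t : Icc a b) :
    w t ∈ (s.sup p).closedBall x₀ ε :=
  (Seminorm.mem_closedBall _).2 <| Seminorm.finset_sup_apply_le hε fun _ hi =>
    (hw.seminorm_sub_le hp ht₀ (fun t => (Seminorm.le_finset_sup_apply hi).trans (hC t)) t).trans
      (hCε t t.2)

theorem IsPicardIterate.dist_weightedCurve_le (hw₁ : IsPicardIterate f t₀ x₀ z₁ w₁)
    (hw₂ : IsPicardIterate f t₀ x₀ z₂ w₂) (hp : WithSeminorms p) (ht₀ : t₀ ∈ Icc a b)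
    {c : ι → ℝ≥0} (hlip : ∀ t ∈ Icc a b, LipschitzOnSeminorms p c B fun x => f (t, x))
    (hz₁ : ∀ t, z₁ t ∈ B) (hz₂ : ∀ t, z₂ t ∈ B) (i : ι) :
    dist (weightedCurve hp (bieleckiWeight (Icc a b) t₀ ∘ c) (w₁.restrict (Icc a b)) i)
        (weightedCurve hp (bieleckiWeight (Icc a b) t₀ ∘ c) (w₂.restrict (Icc a b)) i) ≤
      2⁻¹ * dist (weightedCurve hp (bieleckiWeight (Icc a b) t₀ ∘ c) z₁ i)
        (weightedCurve hp (bieleckiWeight (Icc a b) t₀ ∘ c) z₂ i) := by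
  let u : C(Icc a b, LocalBanachSpace (p i)) :=
    ⟨fun t => localBanachMap hp i (z₁ t) - localBanachMap hp i (z₂ t), by fun_prop⟩
  have hderiv (t : Icc a b) :=
    (hw₁.hasDerivAt_localBanachMap hp i t).sub (hw₂.hasDerivAt_localBanachMap hp i t)
  have hu : weightedCurve hp (bieleckiWeight (Icc a b) t₀ ∘ c) z₁ i -
      weightedCurve hp (bieleckiWeight (Icc a b) t₀ ∘ c) z₂ i =
      bieleckiWeight (Icc a b) t₀ (c i) • u := (smul_sub _ _ _).symm
  rw [dist_eq_norm, dist_eq_norm, hu, ContinuousMap.norm_le _ (by positivity)]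
  intro t
  have h := norm_bieleckiWeight_smul_le (u := u) (L := c i) (convex_Icc a b)
    (fun t ht => (hderiv ⟨t, ht⟩).differentiableAt.hasDerivAt.hasDerivWithinAt) ht₀
    (by simp [hw₁.initial, hw₂.initial])
    (fun t => by
      rw [(hderiv t).deriv, norm_localBanachMap_sub]
      refine (hlip t t.2 i _ (hz₁ t) _ (hz₂ t)).trans_eq ?_
      rw [← norm_localBanachMap_sub hp]
      rfl) t
  rwa [Pi.sub_apply, smul_sub] at h

end PicardIterate

section Existence

variable {X : Type u} [AddCommGroup X] [Module ℝ X] {ι : Type*} {p : ι → Seminorm ℝ X}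
  {f : ℝ × X → X} {t₀ r : ℝ} {x₀ : X}

theorem IsPicardIterate.isC1Solution [TopologicalSpace X] [ContinuousSMul ℝ X] {B : Set X}
    {z : C(Icc (t₀ - r) (t₀ + r), X)} {w : C(ℝ, X)} (hw : IsPicardIterate f t₀ x₀ z w)
    (hf : ContinuousOn f (Icc (t₀ - r) (t₀ + r) ×ˢ B)) (hz : ∀ t, z t ∈ B)
    (hwz : w.restrict (Icc (t₀ - r) (t₀ + r)) = z) : IsC1Solution f B t₀ x₀ r w := by
  subst hwz
  exact
    { mem := fun t ht => hz ⟨t, ht⟩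
      hasDeriv := fun t ht => (hw.hasDerivAt ⟨t, ht⟩).hasFDerivAt.hasFDerivWithinAt
      continuousOn := w.continuous.continuousOn
      continuousOn_deriv := hf.comp (by fun_prop) fun t ht => ⟨ht, hz ⟨t, ht⟩⟩
      initial := hw.initial }

theorem IsC1Solution.mono [TopologicalSpace X] [ContinuousSMul ℝ X] {B U : Set X} {x : ℝ → X}
    (hx : IsC1Solution f B t₀ x₀ r x) (hBU : B ⊆ U) : IsC1Solution f U t₀ x₀ r x :=
  { hx with mem := fun t ht => hBU (hx.mem t ht) }

variable [UniformSpace X] [IsUniformAddGroup X] [ContinuousSMul ℝ X] [T2Space X] [CompleteSpace X]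

theorem exists_isC1Solution_of_lipschitzOnSeminorms (hp : WithSeminorms p) {s : Finset ι} {ε C : ℝ}
    (hε : 0 ≤ ε) (hr : 0 ≤ r) (hCr : C * r ≤ ε)
    (hf : ContinuousOn f (Icc (t₀ - r) (t₀ + r) ×ˢ (s.sup p).closedBall x₀ ε))
    (hbound : ∀ t ∈ Icc (t₀ - r) (t₀ + r), ∀ x ∈ (s.sup p).closedBall x₀ ε,
      (s.sup p) (f (t, x)) ≤ C) {c : ι → ℝ≥0}
    (hlip : ∀ t ∈ Icc (t₀ - r) (t₀ + r),
      LipschitzOnSeminorms p c ((s.sup p).closedBall x₀ ε) fun x => f (t, x)) :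
    ∃ x, IsC1Solution f ((s.sup p).closedBall x₀ ε) t₀ x₀ r x := by
  set J := Icc (t₀ - r) (t₀ + r)
  set B := (s.sup p).closedBall x₀ ε
  have ht₀ : t₀ ∈ J := ⟨by linarith, by linarith⟩
  have hC : 0 ≤ C :=
    (apply_nonneg _ _).trans (hbound t₀ ht₀ x₀ ((s.sup p).mem_closedBall_self hε))
  have hB : IsClosed B := by
    have := Seminorm.continuous_finsetSup (s := s) fun i _ => hp.continuous_seminorm i
    exact isClosed_Iic.preimage (this.comp (by fun_prop : Continuous fun x => x - x₀))
  have hw (i : ι) (t : J) : (bieleckiWeight J t₀ ∘ c) i t ≠ 0 := (bieleckiWeight_pos J t₀ _ t).ne'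
  choose! P hP using fun (z : C(J, X)) (hz : ∀ t, z t ∈ B) =>
    exists_isPicardIterate hp (ht₀.1.trans ht₀.2) hf t₀ x₀ hz
  have hCε (t : ℝ) (ht : t ∈ J) : C * |t - t₀| ≤ ε :=
    (mul_le_mul_of_nonneg_left (abs_sub_le_iff.2
      ⟨by linarith [ht.2], by linarith [ht.1]⟩) hC).trans hCr
  obtain ⟨z, hz, hfix⟩ := exists_eq_map_of_dist_map_le (S := {z : C(J, X) | ∀ t, z t ∈ B})
    (κ := fun _ => 2⁻¹) (T := fun z => (P z).restrict J)
    ⟨ContinuousMap.const J x₀, fun _ => (s.sup p).mem_closedBall_self hε⟩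
    (isClosed_image_weightedCurve hp hw hB)
    (fun z hz t => (hP z hz).mem_closedBall hp ht₀ hε (fun t => hbound t t.2 _ (hz t)) hCε t)
    (fun _ => by norm_num) fun i y hy z hz => by
      simpa using (hP y hy).dist_weightedCurve_le (hP z hz) hp ht₀ hlip hy hz i
  exact ⟨P z, (hP z hz).isC1Solution hf hz (weightedCurve_injective hp hw hfix)⟩

theorem exists_pos_isC1Solution_of_lipschitzOnSeminorms (hp : WithSeminorms p) {s : Finset ι}
    {ε r₀ : ℝ} (hε : 0 < ε) (hr₀ : 0 < r₀)
    (hf : ContinuousOn f (Icc (t₀ - r₀) (t₀ + r₀) ×ˢ (s.sup p).closedBall x₀ ε)) {c : ι → ℝ≥0}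
    (hlip : ∀ t ∈ Icc (t₀ - r₀) (t₀ + r₀),
      LipschitzOnSeminorms p c ((s.sup p).closedBall x₀ ε) fun x => f (t, x)) :
    ∃ r, 0 < r ∧ r ≤ r₀ ∧ ∃ x, IsC1Solution f ((s.sup p).closedBall x₀ ε) t₀ x₀ r x := by
  obtain ⟨C, hC, hbound⟩ :=
    exists_seminorm_le_of_lipschitzOnSeminorms hp hε.le isCompact_Icc hf hlip
  obtain ⟨r, hr, hrr₀, hrC⟩ : ∃ r, 0 < r ∧ r ≤ r₀ ∧ r ≤ ε / C :=
    ⟨min r₀ (ε / C), by positivity, min_le_left _ _, min_le_right _ _⟩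
  have hsub : Icc (t₀ - r) (t₀ + r) ⊆ Icc (t₀ - r₀) (t₀ + r₀) := by gcongr
  exact ⟨r, hr, hrr₀, exists_isC1Solution_of_lipschitzOnSeminorms hp hε.le hr.le
    ((le_div_iff₀' hC).1 hrC) (hf.mono (prod_mono_left hsub))
    (fun t ht => hbound t (hsub ht)) fun t ht => hlip t (hsub ht)⟩

end Existence

section LocallyLipschitz

variable {X : Type u} [AddCommGroup X] [Module ℝ X] {ι : Type*} {p : ι → Seminorm ℝ X}
  {c : ι → ℝ≥0} {J : Set ℝ} {U : Set X} {f : ℝ × X → X}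

/-- Every point of `U` has a neighbourhood in `U`, a closed ball of one of the continuous seminorms
`s.sup p`, on which all the maps `f (t, ·)`, `t ∈ J`, are Lipschitz for each seminorm `p i`, with
constant `c i`. The constants do not depend on the point. -/
def LocallyLipschitzOnSeminorms (p : ι → Seminorm ℝ X) (c : ι → ℝ≥0) (J : Set ℝ) (U : Set X)
    (f : ℝ × X → X) : Prop :=
  ∀ x ∈ U, ∃ (s : Finset ι) (ε : ℝ), 0 < ε ∧ (s.sup p).closedBall x ε ⊆ U ∧
    ∀ t ∈ J, LipschitzOnSeminorms p c ((s.sup p).closedBall x ε) fun y => f (t, y)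

theorem LocallyLipschitzOnSeminorms.mono (hf : LocallyLipschitzOnSeminorms p c J U f)
    {J' : Set ℝ} (hJ : J' ⊆ J) : LocallyLipschitzOnSeminorms p c J' U f := fun x hx =>
  let ⟨s, ε, hε, hU, hlip⟩ := hf x hx
  ⟨s, ε, hε, hU, fun t ht => hlip t (hJ ht)⟩

variable [TopologicalSpace X] [IsTopologicalAddGroup X] [ContinuousSMul ℝ X]

theorem locallyLipschitzOnSeminorms_of_hasGateauxDerivAt (hp : WithSeminorms p) (hU : IsOpen U)
    {Dxf : ℝ → X → X →L[ℝ] X}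
    (hDxf : ∀ t ∈ J, ∀ x ∈ U, HasGateauxDerivAt (fun y => f (t, y)) (Dxf t x) x)
    (hbound : ∀ t ∈ J, ∀ x ∈ U, ∀ u i, p i (Dxf t x u) ≤ c i * p i u) :
    LocallyLipschitzOnSeminorms p c J U f := fun x hx => by
  obtain ⟨s, ε, hε, hball⟩ := (hp.mem_nhds_iff x U).1 (hU.mem_nhds hx)
  have hsub : (s.sup p).closedBall x (ε / 2) ⊆ U := fun y hy =>
    hball (((s.sup p).mem_closedBall.1 hy).trans_lt (half_lt_self hε))
  exact ⟨s, ε / 2, half_pos hε, hsub, fun t ht =>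
    lipschitzOnSeminorms_of_hasGateauxDerivAt hp ((s.sup p).convex_closedBall x (ε / 2))
      (fun y hy => hDxf t ht y (hsub hy)) fun y hy => hbound t ht y (hsub hy)⟩

variable {t₀ r : ℝ} {x₀ : X} {x y : ℝ → X}

theorem LocallyLipschitzOnSeminorms.eventuallyEq_of_isC1Solution [T0Space X]
    (hf : LocallyLipschitzOnSeminorms p c (Icc (t₀ - r) (t₀ + r)) U f) (hp : WithSeminorms p)
    (hx : IsC1Solution f U t₀ x₀ r x) (hy : IsC1Solution f U t₀ x₀ r y) {t₁ : ℝ}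
    (ht₁ : t₁ ∈ Icc (t₀ - r) (t₀ + r)) (h₁ : x t₁ = y t₁) :
    x =ᶠ[𝓝[Icc (t₀ - r) (t₀ + r)] t₁] y := by
  set J := Icc (t₀ - r) (t₀ + r)
  obtain ⟨s, ε, hε, -, hlip⟩ := hf (x t₁) (hx.mem t₁ ht₁)
  have hB : (s.sup p).closedBall (x t₁) ε ∈ 𝓝 (x t₁) := (hp.mem_nhds_iff _ _).2
    ⟨s, ε, hε, fun z hz => ((s.sup p).mem_ball.1 hz).le⟩
  obtain ⟨δ, hδ, hball⟩ := Metric.mem_nhdsWithin_iff.1 <|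
    inter_mem (hx.continuousOn t₁ ht₁ hB)
      (hy.continuousOn t₁ ht₁ (by rwa [← h₁] : (s.sup p).closedBall (x t₁) ε ∈ 𝓝 (y t₁)))
  set I := Metric.ball t₁ δ ∩ J
  have hderiv {z : ℝ → X} (hz : IsC1Solution f U t₀ x₀ r z) (i : ι) (t : ℝ) (ht : t ∈ I) :
      HasDerivWithinAt (fun t => localBanachMap hp i (z t)) (localBanachMap hp i (f (t, z t)))
        I t :=
    HasDerivWithinAt.mono (hasDerivAtFilter_localBanachMap hp i (hz.hasDeriv t ht.2))
      inter_subset_right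
  have hzero (i : ι) : EqOn (fun t => localBanachMap hp i (x t) - localBanachMap hp i (y t)) 0 I :=
    eqOn_zero_of_norm_deriv_le_mul_norm ((convex_ball t₁ δ).inter (convex_Icc _ _))
      (fun t ht => (hderiv hx i t ht).sub (hderiv hy i t ht))
      (fun t ht => by
        rw [norm_localBanachMap_sub, norm_localBanachMap_sub]
        exact hlip t ht.2 i _ (hball ht).1 _ (hball ht).2)
      ⟨Metric.mem_ball_self hδ, ht₁⟩ (by rw [h₁, sub_self])
  exact Metric.mem_nhdsWithin_iff.2 ⟨δ, hδ, fun t ht =>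
    localBanachEmbedding_injective hp (funext fun i => sub_eq_zero.1 (hzero i ht))⟩

theorem LocallyLipschitzOnSeminorms.eqOn_of_isC1Solution [T2Space X]
    (hf : LocallyLipschitzOnSeminorms p c (Icc (t₀ - r) (t₀ + r)) U f) (hp : WithSeminorms p)
    (hx : IsC1Solution f U t₀ x₀ r x) (hy : IsC1Solution f U t₀ x₀ r y) :
    EqOn x y (Icc (t₀ - r) (t₀ + r)) := fun t ht => by
  have : PreconnectedSpace (Icc (t₀ - r) (t₀ + r)) :=
    isPreconnected_iff_preconnectedSpace.1 isPreconnected_Icc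
  have hclopen : IsClopen {t : Icc (t₀ - r) (t₀ + r) | x t = y t} :=
    ⟨isClosed_eq hx.continuousOn.domRestrict hy.continuousOn.domRestrict,
      isOpen_iff_mem_nhds.2 fun t₁ h₁ => preimage_coe_mem_nhds_subtype.2
        (hf.eventuallyEq_of_isC1Solution hp hx hy t₁.2 h₁)⟩
  have huniv := hclopen.eq_univ
    ⟨⟨t₀, by linarith [ht.1.trans ht.2], by linarith [ht.1.trans ht.2]⟩,
      hx.initial.trans hy.initial.symm⟩
  exact eq_univ_iff_forall.1 huniv ⟨t, ht⟩

end LocallyLipschitz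

theorem LocallyLipschitzOnSeminorms.exists_isC1Solution {X : Type u} [AddCommGroup X] [Module ℝ X]
    [UniformSpace X] [IsUniformAddGroup X] [ContinuousSMul ℝ X] [T2Space X] [CompleteSpace X]
    {ι : Type*} {p : ι → Seminorm ℝ X} {c : ι → ℝ≥0} {t₀ r₀ : ℝ} {U : Set X} {f : ℝ × X → X}
    (hlip : LocallyLipschitzOnSeminorms p c (Icc (t₀ - r₀) (t₀ + r₀)) U f)
    (hp : WithSeminorms p) (hf : ContinuousOn f (Icc (t₀ - r₀) (t₀ + r₀) ×ˢ U)) (hr₀ : 0 < r₀)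
    {x₀ : X} (hx₀ : x₀ ∈ U) :
    ∃ r, 0 < r ∧ r ≤ r₀ ∧ ∃ x, IsC1Solution f U t₀ x₀ r x := by
  obtain ⟨s, ε, hε, hU, hlip⟩ := hlip x₀ hx₀
  obtain ⟨r, hr, hrr₀, x, hx⟩ := exists_pos_isC1Solution_of_lipschitzOnSeminorms hp hε hr₀
    (hf.mono (prod_mono_right hU)) hlip
  exact ⟨r, hr, hrr₀, x, hx.mono hU⟩

theorem theorem4p1_general {X : Type*} [AddCommGroup X] [Module ℝ X] [UniformSpace X]
    [IsUniformAddGroup X] [ContinuousSMul ℝ X] [T2Space X] [CompleteSpace X]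
    {ι : Type*} {p : ι → Seminorm ℝ X} (hp : WithSeminorms p)
    {U : Set X} (hU : IsOpen U) {x₀ : X} (hx₀ : x₀ ∈ U) {t₀ r₀ : ℝ} (hr₀ : 0 < r₀)
    {f : ℝ × X → X} (hf : ContinuousOn f (Icc (t₀ - r₀) (t₀ + r₀) ×ˢ U))
    {Dxf : ℝ → X → X →L[ℝ] X}
    (hDxf : ∀ t ∈ Icc (t₀ - r₀) (t₀ + r₀), ∀ x ∈ U,
      HasGateauxDerivAt (fun y => f (t, y)) (Dxf t x) x)
    {c : ι → ℝ}
    (hbound : ∀ t ∈ Icc (t₀ - r₀) (t₀ + r₀), ∀ x ∈ U, ∀ u i, p i (Dxf t x u) ≤ c i * p i u) :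
    (∃ r, 0 < r ∧ r ≤ r₀ ∧ ∃ x, IsC1Solution f U t₀ x₀ r x) ∧
    ∀ r ≤ r₀, ∀ x y, IsC1Solution f U t₀ x₀ r x → IsC1Solution f U t₀ x₀ r y →
      EqOn x y (Icc (t₀ - r) (t₀ + r)) := by
  have hlip : LocallyLipschitzOnSeminorms p (fun i => (c i).toNNReal)
      (Icc (t₀ - r₀) (t₀ + r₀)) U f :=
    locallyLipschitzOnSeminorms_of_hasGateauxDerivAt hp hU hDxf fun t ht x hx u i =>
      (hbound t ht x hx u i).trans (by gcongr; exact Real.le_coe_toNNReal (c i))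
  refine ⟨hlip.exists_isC1Solution hp hf hr₀ hx₀, fun r hr x y hx hy => ?_⟩
  exact (hlip.mono (by gcongr)).eqOn_of_isC1Solution hp hx hy

theorem theorem4p1 {X : Type*} [AddCommGroup X] [Module ℝ X] [UniformSpace X]
    [IsUniformAddGroup X] [ContinuousSMul ℝ X]
    (p : ℕ → Seminorm ℝ X) (_hX : IsGradedFrechet p)
    (_hstd : IsStandard p) (_hstdC : IsStandard (fun k => pathSeminorm (p k)))
    (U : Set X) (_hU : IsOpen U) (x₀ : X) (_hx₀ : x₀ ∈ U)
    (t₀ r₀ : ℝ) (_hr₀ : 0 < r₀)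
    (f : ℝ × X → X) (_hf : ContinuousOn f (Icc (t₀ - r₀) (t₀ + r₀) ×ˢ U))
    (Dxf : ℝ → X → X →L[ℝ] X)
    (_hDxf : ∀ t ∈ Icc (t₀ - r₀) (t₀ + r₀), ∀ x ∈ U,
      HasGateauxDerivAt (fun y => f (t, y)) (Dxf t x) x)
    (c : ℕ → ℝ) (_hc_mono : Monotone c) (_hc_nonneg : ∀ k, 0 ≤ c k)
    (_hbound : ∀ t ∈ Icc (t₀ - r₀) (t₀ + r₀), ∀ x ∈ U, ∀ (u : X) (k : ℕ),
      p k (Dxf t x u) ≤ c k * p k u) :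
    (∃ r : ℝ, 0 < r ∧ r ≤ r₀ ∧ ∃ x : ℝ → X, IsC1Solution f U t₀ x₀ r x) ∧
    (∀ Df : ℝ × X → ℝ × X →L[ℝ] X,
      IsC1On f Df (Icc (t₀ - r₀) (t₀ + r₀) ×ˢ U) →
      (∀ t ∈ Icc (t₀ - r₀) (t₀ + r₀), ∀ x ∈ U, ∀ (τ : ℝ) (u : X) (k : ℕ),
        p k (Df (t, x) (τ, u)) ≤ c k * (|τ| + p k u)) →
      ∀ r : ℝ, 0 < r → r ≤ r₀ → ∀ x y : ℝ → X,
        IsC1Solution f U t₀ x₀ r x → IsC1Solution f U t₀ x₀ r y →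
        EqOn x y (Icc (t₀ - r) (t₀ + r))) := by
  have := _hX.t2
  have := _hX.complete
  have h := theorem4p1_general _hX.withSeminorms _hU _hx₀ _hr₀ _hf _hDxf _hbound
  exact ⟨h.1, fun _ _ _ r _ => h.2 r⟩
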